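/- Define the bivariate Catalan numbers by $C(m,n)=\dfrac{(2m)!\,(2n)!}{m!\,(m+n)!\,n!}$ for integers $m,n\ge 0$. For a composition $\alpha=(a_1,\dots,a_k)$ of a non-negative integer (a finite, possibly empty, sequence of positive integers with that sum) put \[p_-(\alpha)=\#\{i\neq k: a_i>1\},\qquad p_+(\alpha)=\begin{cases}1+\#\{i\neq 1,k: a_i>1\}&\text{if }k>1,\\ 0&\text{if }k\le 1.\end{cases}\] The ribbon diagram of $\alpha$ consists of $k$ rows of squares, the $i$-th row having $a_i$ squares, with the first square of row $i+1$ directly below the last square of row $i$. If $\alpha$ is a composition of $n$, label the edges between consecutive squares, read from left to right and top to bottom, from $0$ to $n$, including the first and the last edge; thus edge $i$ comes right after the $i$-th square. Let $L_i(\alpha)$ (a composition of $i$) and $R_i(\alpha)$ (a composition of $n-i$) be the compositions whose ribbon diagrams are the left and the right piece obtained by cutting the ribbon diagram of $\alpha$ along edge $i$; in particular $L_0(\alpha)=R_n(\alpha)=(\,)$ and $R_0(\alpha)=L_n(\alpha)=\alpha$. Write $\ell_\pm^i(\alpha)=p_\pm(L_i(\alpha))$ and $r_\pm^i(\alpha)=p_\pm(R_i(\alpha))$.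 Then for any composition $\alpha$ of a positive integer $n$, \[\sum_{j=0}^{\lfloor n/2\rfloor}(-1)^{\ell_+^{2j}(\alpha)+r_-^{2j}(\alpha)}\,C\bigl(\ell_+^{2j}(\alpha),\,j-\ell_+^{2j}(\alpha)\bigr)\,C\bigl(r_-^{2j}(\alpha),\,\lfloor n/2\rfloor-j-r_-^{2j}(\alpha)\bigr)=\begin{cases}4^{\lfloor n/2\rfloor}&\text{if }\alpha=(n),\\0&\text{otherwise,}\end{cases}\] and \[\sum_{i=0}^{n}\frac{(-1)^{\ell_-^{i}(\alpha)+r_-^{i}(\alpha)+i}}{4^{\lfloor i/2\rfloor+\lfloor (n-i)/2\rfloor}}\,C\bigl(\ell_-^{i}(\alpha),\,\lfloor i/2\rfloor-\ell_-^{i}(\alpha)\bigr)\,C\bigl(r_-^{i}(\alpha),\,\lfloor (n-i)/2\rfloor-r_-^{i}(\alpha)\bigr)=0.\] -/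

import Mathlib

/-- The bivariate Catalan number `C(m, n) = (2m)! (2n)! / (m! (m+n)! n!)`, as a rational number. -/
def bivariateCatalan (m n : ℕ) : ℚ :=
  ((Nat.factorial (2 * m) : ℚ) * (Nat.factorial (2 * n) : ℚ)) /
    ((Nat.factorial m : ℚ) * (Nat.factorial (m + n) : ℚ) * (Nat.factorial n : ℚ))

namespace Composition

/-- `p₋(α) = #{i ≠ k : aᵢ > 1}` for `α = (a₁, …, aₖ)`. The index `i : Fin k` is the position
`i + 1` in the one-based numbering. -/
def peakMinus {n : ℕ} (α : Composition n) : ℕ :=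
  (Finset.univ.filter fun i : Fin α.length =>
    (i : ℕ) + 1 ≠ α.length ∧ 1 < α.blocksFun i).card

/-- `p₊(α) = 1 + #{i ≠ 1, k : aᵢ > 1}` if `k > 1`, and `p₊(α) = 0` if `k ≤ 1`,
for `α = (a₁, …, aₖ)`. -/
def peakPlus {n : ℕ} (α : Composition n) : ℕ :=
  if 1 < α.length then
    1 + (Finset.univ.filter fun i : Fin α.length =>
      (i : ℕ) + 1 ≠ 1 ∧ (i : ℕ) + 1 ≠ α.length ∧ 1 < α.blocksFun i).card
  else 0

/-- Row lengths of the left piece (the first `i` squares) when the ribbon with rows of lengths `l`,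
read from left to right and top to bottom, is cut after its `i`-th square. -/
def cutLeftBlocks : ℕ → List ℕ → List ℕ
  | _, [] => []
  | i, a :: l => if i = 0 then [] else if i ≤ a then [i] else a :: cutLeftBlocks (i - a) l

/-- Row lengths of the right piece (all squares but the first `i`) when the ribbon with rows of
lengths `l`, read from left to right and top to bottom, is cut after its `i`-th square. -/
def cutRightBlocks : ℕ → List ℕ → List ℕ
  | _, [] => []
  | i, a :: l => if i < a then (a - i) :: l else cutRightBlocks (i - a) l

theorem cutLeftBlocks_pos (l : List ℕ) (hl : ∀ b ∈ l, 0 < b) (i b : ℕ)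
    (hb : b ∈ cutLeftBlocks i l) : 0 < b := by
  induction l generalizing i with
  | nil => simp [cutLeftBlocks] at hb
  | cons a l ih =>
    unfold cutLeftBlocks at hb
    split_ifs at hb with h1 h2
    · simp at hb
    · simp at hb
      omega
    · rcases List.mem_cons.1 hb with h | h
      · exact hl b (by simp [h])
      · exact ih (fun c hc => hl c (List.mem_cons_of_mem _ hc)) _ h

theorem cutLeftBlocks_sum (l : List ℕ) (i : ℕ) : (cutLeftBlocks i l).sum = min i l.sum := by
  induction l generalizing i with
  | nil => simp [cutLeftBlocks]
  | cons a l ih =>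
    unfold cutLeftBlocks
    split_ifs with h1 h2
    · simp [h1]
    · simp only [List.sum_cons, List.sum_nil]
      omega
    · simp only [List.sum_cons, ih]
      omega

theorem cutRightBlocks_pos (l : List ℕ) (hl : ∀ b ∈ l, 0 < b) (i b : ℕ)
    (hb : b ∈ cutRightBlocks i l) : 0 < b := by
  induction l generalizing i with
  | nil => simp [cutRightBlocks] at hb
  | cons a l ih =>
    unfold cutRightBlocks at hb
    split_ifs at hb with h1
    · rcases List.mem_cons.1 hb with h | h
      · omega
      · exact hl b (List.mem_cons_of_mem _ h)
    · exact ih (fun c hc => hl c (List.mem_cons_of_mem _ hc)) _ hb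

theorem cutRightBlocks_sum (l : List ℕ) (i : ℕ) : (cutRightBlocks i l).sum = l.sum - i := by
  induction l generalizing i with
  | nil => simp [cutRightBlocks]
  | cons a l ih =>
    unfold cutRightBlocks
    split_ifs with h1
    · simp only [List.sum_cons]
      omega
    · simp only [List.sum_cons, ih]
      omega

/-- `Lᵢ(α)`: the composition whose ribbon diagram is the left piece after cutting the ribbon diagram
of `α` along edge `i`, `0 ≤ i ≤ n` (edge `i` lies between the `i`-th and the `(i+1)`-st square).
It is a composition of `i`; for `i > n` the value is `α` by convention. -/
def leftPiece {n : ℕ} (α : Composition n) (i : ℕ) : Composition (min i n) where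
  blocks := cutLeftBlocks i α.blocks
  blocks_pos := fun h => cutLeftBlocks_pos α.blocks (fun _ hb => α.blocks_pos hb) i _ h
  blocks_sum := by rw [cutLeftBlocks_sum, α.blocks_sum]

/-- `Rᵢ(α)`: the composition of `n - i` whose ribbon diagram is the right piece after cutting the
ribbon diagram of `α` along edge `i`, `0 ≤ i ≤ n`. -/
def rightPiece {n : ℕ} (α : Composition n) (i : ℕ) : Composition (n - i) where
  blocks := cutRightBlocks i α.blocks
  blocks_pos := fun h => cutRightBlocks_pos α.blocks (fun _ hb => α.blocks_pos hb) i _ h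
  blocks_sum := by rw [cutRightBlocks_sum, α.blocks_sum]

end Composition

/-! Both identities are convolution identities between linear functionals on quasisymmetric
functions, evaluated at the fundamental function of `α`; cutting the ribbon is the coproduct. The
first says that the universal character (1 on a single row, 0 otherwise) is the product of its even
and odd parts, the second that the odd part, twisted by (-1)^degree, is its own inverse under
convolution. The signed numbers `C` over powers of 4 are the values of these parts.

In the monomial basis the values become simple. A step `right` is `down + diff`, so an additive
function is determined by words without `right` (`Additive.eq_of_forall_right_notMem`), and such
words are cut only at `down`. There the recurrence `normalizedCatalan_eq_add` makes pairs of `diff`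
cancel: the odd part vanishes if the last part is even, and otherwise is (-1)^(number of even parts)
times binom(2m, m) / 4^m, where m is half the number of odd parts, rounded down
(`value_eq_evenSign_mul`).

Convolutions therefore reduce (`cutSum_value`) to self-convolutions of binom(2m, m) / 4^m, the
coefficients of (1 - x)^(-1/2), whose square 1 / (1 - x) has all coefficients 1. If there is an odd
part, the cuts with an even and those with an odd number of odd parts on the left each contribute 1,
so a weight `ω` of period two gives `ω 0 + ω 1`: this is 0 for the alternating weight and 1 for the
indicator of even degrees. -/

/-! ### Normalized bivariate Catalan numbers -/

/-- The bivariate Catalan number `C(m, n)` divided by `4 ^ (m + n)`. -/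
def normalizedCatalan (m n : ℕ) : ℚ :=
  bivariateCatalan m n / 4 ^ (m + n)

theorem bivariateCatalan_eq_four_pow_mul (m n : ℕ) :
    bivariateCatalan m n = 4 ^ (m + n) * normalizedCatalan m n := by
  unfold normalizedCatalan
  field_simp

theorem normalizedCatalan_zero_zero : normalizedCatalan 0 0 = 1 := by
  simp [normalizedCatalan, bivariateCatalan]

/-- This recurrence is what allows a peak of the ribbon to be traded for a difference of two
peakless values in `value`. -/
theorem normalizedCatalan_eq_add (m n : ℕ) :
    normalizedCatalan m n = normalizedCatalan (m + 1) n + normalizedCatalan m (n + 1) := by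
  have h1 : 2 * (m + 1) = 2 * m + 1 + 1 := by ring
  have h2 : 2 * (n + 1) = 2 * n + 1 + 1 := by ring
  have h3 : m + 1 + n = m + n + 1 := by ring
  have h4 : m + (n + 1) = m + n + 1 := by ring
  have hm := Nat.factorial_ne_zero m
  have hn := Nat.factorial_ne_zero n
  have hmn := Nat.factorial_ne_zero (m + n)
  have hs : (m : ℚ) + n + 1 ≠ 0 := by positivity
  simp only [normalizedCatalan, bivariateCatalan, h1, h2, h3, h4, Nat.factorial_succ, pow_succ]
  push_cast
  field_simp
  ring

theorem normalizedCatalan_zero_succ (m : ℕ) :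
    2 * ((m : ℚ) + 1) * normalizedCatalan 0 (m + 1) = (2 * m + 1) * normalizedCatalan 0 m := by
  have h1 : 2 * (m + 1) = 2 * m + 1 + 1 := by ring
  have hm := Nat.factorial_ne_zero m
  simp only [normalizedCatalan, bivariateCatalan, h1, zero_add, Nat.factorial_succ, pow_succ]
  push_cast
  field_simp
  ring

/-- The square of (1 - x)^(-1/2) is 1 / (1 - x). The proof is the differential equation in
coefficient form: by symmetry the index `p.1` averages to `m / 2`, and `normalizedCatalan_zero_succ`
then links consecutive sums. -/
theorem sum_antidiagonal_normalizedCatalan_zero (m : ℕ) :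
    ∑ p ∈ Finset.HasAntidiagonal.antidiagonal m, normalizedCatalan 0 p.1 * normalizedCatalan 0 p.2 = 1 := by
  have half (m : ℕ) : 2 * ∑ p ∈ Finset.HasAntidiagonal.antidiagonal m,
      (p.1 : ℚ) * (normalizedCatalan 0 p.1 * normalizedCatalan 0 p.2) =
        m * ∑ p ∈ Finset.HasAntidiagonal.antidiagonal m, normalizedCatalan 0 p.1 * normalizedCatalan 0 p.2 := by
    rw [two_mul]
    nth_rewrite 2 [← Finset.Nat.sum_antidiagonal_swap]
    rw [← Finset.sum_add_distrib, Finset.mul_sum]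
    refine Finset.sum_congr rfl fun p hp => ?_
    rw [← Finset.HasAntidiagonal.mem_antidiagonal.1 hp]
    simp only [Prod.fst_swap, Prod.snd_swap]
    push_cast
    ring
  induction m with
  | zero => simp [normalizedCatalan_zero_zero]
  | succ m ih =>
    have h := half (m + 1)
    rw [Finset.Nat.sum_antidiagonal_succ] at h
    have h' : 2 * ∑ p ∈ Finset.HasAntidiagonal.antidiagonal m, ((p.1 + 1 : ℕ) : ℚ) *
        (normalizedCatalan 0 (p.1 + 1) * normalizedCatalan 0 p.2) =
        2 * (∑ p ∈ Finset.HasAntidiagonal.antidiagonal m,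
          (p.1 : ℚ) * (normalizedCatalan 0 p.1 * normalizedCatalan 0 p.2)) +
        ∑ p ∈ Finset.HasAntidiagonal.antidiagonal m, normalizedCatalan 0 p.1 * normalizedCatalan 0 p.2 := by
      rw [Finset.mul_sum, Finset.mul_sum, ← Finset.sum_add_distrib]
      refine Finset.sum_congr rfl fun p _ => ?_
      have := normalizedCatalan_zero_succ p.1
      push_cast
      linear_combination normalizedCatalan 0 p.2 * this
    rw [half, ih] at h'
    simp only [Nat.cast_zero, zero_mul, zero_add] at h
    rw [h'] at h
    have hs : ((m + 1 : ℕ) : ℚ) ≠ 0 := by positivity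
    refine mul_left_cancel₀ hs ?_
    rw [← h]
    push_cast
    ring

theorem sum_range_two_mul (g : ℕ → ℚ) (m : ℕ) :
    ∑ s ∈ Finset.range (2 * m), g s =
      (∑ j ∈ Finset.range m, g (2 * j)) + ∑ j ∈ Finset.range m, g (2 * j + 1) := by
  induction m with
  | zero => simp
  | succ m ih =>
    rw [mul_add, mul_one, Finset.sum_range_succ, Finset.sum_range_succ, ih,
      Finset.sum_range_succ, Finset.sum_range_succ]
    ring

/-- The value `C(0, ⌊k/2⌋) / 4 ^ ⌊k/2⌋` attached to a composition with `k` parts, all odd. -/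
def oddPartsValue (k : ℕ) : ℚ :=
  normalizedCatalan 0 (k / 2)

theorem sum_range_oddPartsValue_even (K : ℕ) :
    ∑ j ∈ Finset.range (K / 2 + 1), oddPartsValue (2 * j) * oddPartsValue (K - 2 * j) = 1 := by
  rw [← sum_antidiagonal_normalizedCatalan_zero (K / 2), Finset.Nat.sum_antidiagonal_eq_sum_range_succ_mk]
  refine Finset.sum_congr rfl fun j hj => ?_
  have := Finset.mem_range.1 hj
  simp only [oddPartsValue]
  congr 2 <;> omega

theorem sum_range_oddPartsValue_odd (K : ℕ) :
    ∑ j ∈ Finset.range (K / 2 + 1), oddPartsValue (2 * j + 1) * oddPartsValue (K - 2 * j) = 1 := by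
  rw [← sum_range_oddPartsValue_even K]
  refine Finset.sum_congr rfl fun j _ => ?_
  simp only [oddPartsValue]
  congr 2
  omega

/-- Convolution of the sequence `oddPartsValue` with itself, with weights of period two. -/
theorem sum_range_periodic_mul_oddPartsValue (ω : ℕ → ℚ) (hω : ∀ m, ω (m + 2) = ω m) (K : ℕ) :
    ∑ s ∈ Finset.range (K + 2), ω s * (oddPartsValue s * oddPartsValue (K + 1 - s)) =
      ω 0 + ω 1 := by
  have h0 (j : ℕ) : ω (2 * j) = ω 0 := by
    induction j with
    | zero => rfl
    | succ j ih => rw [← ih, ← hω (2 * j)]; rfl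
  have h1 (j : ℕ) : ω (2 * j + 1) = ω 1 := by
    induction j with
    | zero => rfl
    | succ j ih => rw [← ih, ← hω (2 * j + 1)]; rfl
  have even (K : ℕ) : ∑ j ∈ Finset.range (K / 2 + 1),
      ω (2 * j) * (oddPartsValue (2 * j) * oddPartsValue (K - 2 * j)) = ω 0 := by
    simp_rw [h0]
    rw [← Finset.mul_sum, sum_range_oddPartsValue_even, mul_one]
  have odd : ∑ j ∈ Finset.range (K / 2 + 1),
      ω (2 * j + 1) * (oddPartsValue (2 * j + 1) * oddPartsValue (K + 1 - (2 * j + 1))) =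
        ω 1 := by
    simp_rw [h1, Nat.add_sub_add_right]
    rw [← Finset.mul_sum, sum_range_oddPartsValue_odd, mul_one]
  -- The parity of `K` decides whether the `K + 2` terms split evenly into even and odd indices or
  -- leave one extra even index.
  rcases Nat.even_or_odd' K with ⟨m, rfl | rfl⟩
  · have e := even (2 * m + 1)
    have hd : (2 * m + 1) / 2 = m := by omega
    have hd' : 2 * m / 2 = m := by omega
    rw [hd] at e
    rw [hd'] at odd
    rw [show 2 * m + 2 = 2 * (m + 1) by ring, sum_range_two_mul, e, odd]
  · have e := even (2 * m + 2)
    have hd : (2 * m + 2) / 2 = m + 1 := by omega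
    have hd' : (2 * m + 1) / 2 = m := by omega
    rw [hd, Finset.sum_range_succ] at e
    rw [hd'] at odd
    rw [show 2 * m + 1 + 2 = 2 * (m + 1) + 1 by ring, Finset.sum_range_succ, sum_range_two_mul,
      odd, ← e]
    ring

/-! ### Words of ribbon steps -/

/-- A step between consecutive squares of a ribbon: to the right, down, or the formal difference
`right - down`, which merges two parts of a composition indexing a monomial quasisymmetric
function. -/
inductive RibbonStep
  | right
  | down
  | diff

namespace RibbonStep

/-- A function on words that is additive for the relation `right = down + diff` in each letter. -/
def Additive (f : List RibbonStep → ℚ) : Prop :=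
  ∀ u w, f (u ++ right :: w) = f (u ++ down :: w) + f (u ++ diff :: w)

theorem Additive.cons {f : List RibbonStep → ℚ} (hf : Additive f) (a : RibbonStep) :
    Additive fun u => f (a :: u) :=
  fun u w => hf (a :: u) w

/-- Expanding every `right` is the passage from the fundamental to the monomial basis. -/
theorem Additive.eq_of_forall_right_notMem {f g : List RibbonStep → ℚ} (hf : Additive f)
    (hg : Additive g) (h : ∀ w, right ∉ w → f w = g w) (w : List RibbonStep) : f w = g w := by
  suffices ∀ u, right ∉ u → f (u ++ w) = g (u ++ w) from this [] (by simp)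
  induction w with
  | nil => simpa using h
  | cons a w ih =>
    intro u hu
    have hdown : f (u ++ down :: w) = g (u ++ down :: w) := by
      simpa using ih (u ++ [down]) (by simp [hu])
    have hdiff : f (u ++ diff :: w) = g (u ++ diff :: w) := by
      simpa using ih (u ++ [diff]) (by simp [hu])
    cases a with
    | right => rw [hf, hg, hdown, hdiff]
    | down => exact hdown
    | diff => exact hdiff

/-! ### Convolution over the cuts of a word. -/

/-- The weight of cutting a ribbon at a step. -/
def cutWeight : RibbonStep → ℚ
  | right => 1
  | down => 1
  | diff => 0

/-- The sum over all cuts of a word, the cut after its end included, of the products of the values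
of `F` on the left piece and of `G` on the right piece. -/
def cutSum (F G : List RibbonStep → ℚ) : List RibbonStep → ℚ
  | [] => F []
  | a :: w => cutWeight a * F [] * G w + cutSum (fun u => F (a :: u)) G w

theorem cutSum_add (F₁ F₂ G : List RibbonStep → ℚ) (w : List RibbonStep) :
    cutSum (fun u => F₁ u + F₂ u) G w = cutSum F₁ G w + cutSum F₂ G w := by
  induction w generalizing F₁ F₂ with
  | nil => rfl
  | cons a w ih =>
    simp only [cutSum, ih]
    ring

theorem cutSum_neg (F G : List RibbonStep → ℚ) (w : List RibbonStep) :
    cutSum (fun u => -F u) G w = -cutSum F G w := by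
  induction w generalizing F with
  | nil => rfl
  | cons a w ih =>
    simp only [cutSum, ih]
    ring

theorem Additive.cutSum {F G : List RibbonStep → ℚ} (hF : Additive F) (hG : Additive G) :
    Additive (cutSum F G) := by
  intro u w
  induction u generalizing F with
  | nil =>
    have h : (fun u => F (right :: u)) = fun u => F (down :: u) + F (diff :: u) :=
      funext fun u => hF [] u
    simp only [List.nil_append, RibbonStep.cutSum, h, cutSum_add, cutWeight]
    ring
  | cons a u ih =>
    simp only [List.cons_append, RibbonStep.cutSum, ih (hF.cons a), hG u w]
    ring

theorem cutSum_eq_sum_range (F G : List RibbonStep → ℚ) (w : List RibbonStep)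
    (hw : diff ∉ w) :
    cutSum F G w =
      (∑ i ∈ Finset.range w.length, F (w.take i) * G (w.drop (i + 1))) + F w := by
  induction w generalizing F with
  | nil => simp [cutSum]
  | cons a w ih =>
    have ha : cutWeight a = 1 := by
      cases a <;> simp_all [cutWeight]
    rw [cutSum, ih _ fun h => hw (List.mem_cons_of_mem _ h), List.length_cons,
      Finset.sum_range_succ', ha]
    simp only [List.take_succ_cons, List.drop_succ_cons, List.take_zero, List.drop_zero]
    ring

/-! ### The odd part of the universal character, on monomial words. -/

/-- The value of the odd part of the universal character on a ribbon, as a function of its steps.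
The flag says whether the preceding step was to the right. -/
def value : Bool → ℕ → List RibbonStep → ℚ
  | false, k, [] => oddPartsValue k
  | true, k, [] => oddPartsValue (k + 1)
  | false, k, right :: w => value true k w
  | true, k, right :: w => value true (k + 1) w
  | false, k, down :: w => value false (k + 1) w
  | true, k, down :: w => value false (k + 2) w - value false k w
  | false, k, diff :: w => value true k w - value false (k + 1) w
  | true, k, diff :: w => value true (k + 1) w - (value false (k + 2) w - value false k w)

theorem additive_value (b : Bool) (k : ℕ) : Additive (value b k) := by
  intro u w
  induction u generalizing b k with
  | nil => cases b <;> simp [value]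
  | cons a u ih =>
    cases b <;> cases a <;> simp only [List.cons_append, value, ih] <;> ring

/-- The clause of `value` for a peak is a difference, and it telescopes here; so only the parity of
a part matters. -/
theorem value_diff_diff (k : ℕ) (w : List RibbonStep) :
    value false k (diff :: diff :: w) = value false k w := by
  simp only [value]
  ring

theorem value_diff_down (k : ℕ) (w : List RibbonStep) :
    value false k (diff :: down :: w) = -value false k w := by
  simp only [value]
  ring

theorem value_diff_nil (k : ℕ) : value false k [diff] = 0 := by
  simp [value]

/-- This is `right = down + diff` for an imagined step in front of the ribbon. It expresses the even
part of the character through the odd one. -/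
theorem value_true_eq_add (w : List RibbonStep) :
    value true 0 w = value false 1 w + value false 0 (diff :: w) := by
  simp [value]

/-- The number of parts of odd size of the composition described by a word of steps `down` and
`diff`; the flag is the parity of the part under construction. -/
def oddCount : Bool → List RibbonStep → ℕ
  | true, [] => 1
  | false, [] => 0
  | true, down :: w => oddCount true w + 1
  | false, down :: w => oddCount true w
  | p, _ :: w => oddCount (!p) w

/-- `(-1) ^ e` for the number `e` of parts of even size of the composition described by a word of
steps `down` and `diff` if its last part is odd, and `0` otherwise. -/
def evenSign : Bool → List RibbonStep → ℚ
  | true, [] => 1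
  | false, [] => 0
  | true, down :: w => evenSign true w
  | false, down :: w => -evenSign true w
  | p, _ :: w => evenSign (!p) w

theorem evenSign_eq_zero {p : Bool} {w : List RibbonStep} (h : oddCount p w = 0) :
    evenSign p w = 0 := by
  induction w generalizing p with
  | nil => cases p <;> simp_all [oddCount, evenSign]
  | cons a w ih => cases p <;> cases a <;> simp_all [oddCount, evenSign]

/-- The part under construction is already included in `k`, hence the `- 1`. The subtraction can be
off only when `oddCount` is 0, and then `evenSign` vanishes. -/
theorem value_eq_evenSign_mul (w : List RibbonStep) (hw : right ∉ w) (k : ℕ) :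
    value false k w = evenSign true w * oddPartsValue (k + oddCount true w - 1) ∧
      value false k (diff :: w) =
        evenSign false w * oddPartsValue (k + oddCount false w - 1) := by
  induction w generalizing k with
  | nil => simp [evenSign, oddCount, value]
  | cons a w ih =>
    have ih := ih fun h => hw (List.mem_cons_of_mem _ h)
    cases a with
    | right => simp at hw
    | down =>
      refine ⟨?_, ?_⟩
      · rw [value, (ih (k + 1)).1]
        simp only [evenSign, oddCount]
        congr 2
        omega
      · rw [value_diff_down, (ih k).1]
        simp only [evenSign, oddCount, neg_mul]
    | diff =>
      refine ⟨?_, ?_⟩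
      · rw [(ih k).2]
        simp [evenSign, oddCount]
      · rw [value_diff_diff, (ih k).1]
        simp [evenSign, oddCount]

/-- Only cuts right after an odd part survive, and these are determined by the number of odd parts
on their left, which has the parity of the degree: this is why `ω` needs period two. The signs of
the two pieces multiply to that of the whole word. -/
theorem cutSum_value (ω : ℕ → ℚ) (hω : ∀ m, ω (m + 2) = ω m) (w : List RibbonStep)
    (hw : right ∉ w) (k : ℕ) :
    cutSum (fun u => ω (k + u.length) * value false k u) (value false 1) w =
        evenSign true w * ∑ s ∈ Finset.range (oddCount true w),
          ω (k + s) * (oddPartsValue (k + s) * oddPartsValue (oddCount true w - 1 - s)) ∧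
      cutSum (fun u => ω (k + 1 + u.length) * value false k (diff :: u)) (value false 1) w =
        evenSign false w * ∑ s ∈ Finset.range (oddCount false w),
          ω (k + s) * (oddPartsValue (k + s) * oddPartsValue (oddCount false w - 1 - s)) := by
  induction w generalizing k with
  | nil => simp [cutSum, evenSign, oddCount, value, oddPartsValue,
      normalizedCatalan_zero_zero]
  | cons a w ih =>
    have hw' : right ∉ w := fun h => hw (List.mem_cons_of_mem _ h)
    have ih := ih hw'
    cases a with
    | right => simp at hw
    | down =>
      refine ⟨?_, ?_⟩
      · have e : (fun u : List RibbonStep =>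
            ω (k + (down :: u).length) * value false k (down :: u)) =
            fun u => ω (k + 1 + u.length) * value false (k + 1) u := by
          funext u
          rw [List.length_cons, value, show k + (u.length + 1) = k + 1 + u.length by ring]
        rw [cutSum, e, (ih (k + 1)).1, (value_eq_evenSign_mul w hw' 1).1]
        -- The cut at this `down` is the term `s = 0`; the later cuts are the shifted sum.
        simp only [evenSign, oddCount, Finset.sum_range_succ' _ (oddCount true w), cutWeight,
          List.length_nil, value]
        have e' : ∑ s ∈ Finset.range (oddCount true w), ω (k + (s + 1)) *
            (oddPartsValue (k + (s + 1)) *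
              oddPartsValue (oddCount true w + 1 - 1 - (s + 1))) =
            ∑ s ∈ Finset.range (oddCount true w), ω (k + 1 + s) *
              (oddPartsValue (k + 1 + s) * oddPartsValue (oddCount true w - 1 - s)) := by
          refine Finset.sum_congr rfl fun s _ => ?_
          rw [show k + (s + 1) = k + 1 + s by ring,
            show oddCount true w + 1 - 1 - (s + 1) = oddCount true w - 1 - s by omega]
        rw [e', show 1 + oddCount true w - 1 = oddCount true w + 1 - 1 - 0 by omega]
        simp only [add_zero]
        ring
      -- An even part is completed: it only changes the sign, and its two steps are invisible to
      -- `ω`.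
      · have e : (fun u : List RibbonStep =>
            ω (k + 1 + (down :: u).length) * value false k (diff :: down :: u)) =
            fun u => -(ω (k + u.length) * value false k u) := by
          funext u
          rw [List.length_cons, value_diff_down,
            show k + 1 + (u.length + 1) = k + u.length + 2 by ring, hω]
          ring
        rw [cutSum, e, cutSum_neg, (ih k).1, value_diff_nil]
        simp only [evenSign, oddCount]
        ring
    | diff =>
      refine ⟨?_, ?_⟩
      · have e : (fun u : List RibbonStep =>
            ω (k + (diff :: u).length) * value false k (diff :: u)) =
            fun u => ω (k + 1 + u.length) * value false k (diff :: u) := by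
          funext u
          rw [List.length_cons, show k + (u.length + 1) = k + 1 + u.length by ring]
        rw [cutSum, e, (ih k).2]
        simp [evenSign, oddCount, cutWeight]
      · have e : (fun u : List RibbonStep =>
            ω (k + 1 + (diff :: u).length) * value false k (diff :: diff :: u)) =
            fun u => ω (k + u.length) * value false k u := by
          funext u
          rw [List.length_cons, value_diff_diff,
            show k + 1 + (u.length + 1) = k + u.length + 2 by ring, hω]
        rw [cutSum, e, (ih k).1]
        simp [evenSign, oddCount, cutWeight]

theorem additive_mul_value (ω : ℕ → ℚ) (b : Bool) (k m : ℕ) :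
    Additive fun u => ω (m + u.length) * value b k u := by
  intro u w
  simp only [additive_value b k u w, List.length_append, List.length_cons]
  ring

theorem evenSign_mul_sum_range (ω : ℕ → ℚ) (hω : ∀ m, ω (m + 2) = ω m) (p : Bool)
    (w : List RibbonStep) :
    evenSign p w * ∑ s ∈ Finset.range (oddCount p w + 1),
        ω s * (oddPartsValue s * oddPartsValue (oddCount p w - s)) =
      evenSign p w * (ω 0 + ω 1) := by
  rcases h : oddCount p w with _ | K
  · simp [evenSign_eq_zero h]
  · rw [sum_range_periodic_mul_oddPartsValue ω hω]

/-! ### The two convolution identities on words. -/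

/-- The odd part of the universal character has its conjugate as convolution inverse. -/
theorem value_add_cutSum_conjugate_eq_zero (w : List RibbonStep) :
    value false 1 w +
      cutSum (fun u => (-1) ^ (1 + u.length) * value false 1 u) (value false 1) w = 0 := by
  refine Additive.eq_of_forall_right_notMem
    (f := fun w => value false 1 w +
      cutSum (fun u => (-1) ^ (1 + u.length) * value false 1 u) (value false 1) w)
    (g := fun _ => 0) ?_ (fun _ _ => by simp) ?_ w
  · intro u w
    have h := (additive_mul_value (fun m => (-1) ^ m) false 1 1).cutSum (additive_value false 1) u w
    simp only at h ⊢
    rw [h, additive_value false 1 u w]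
    ring
  · intro w hw
    have hω : ∀ m, (-1 : ℚ) ^ (m + 2) = (-1) ^ m := fun m => by ring
    have h := evenSign_mul_sum_range _ hω true w
    simp only [pow_zero, pow_one, add_neg_cancel, mul_zero] at h
    simp only [(cutSum_value _ hω w hw 1).1, (value_eq_evenSign_mul w hw 1).1]
    -- The term `s = 0` is the cut before the first square, which `cutSum` omits.
    rw [Finset.sum_range_succ', mul_add] at h
    rw [← h, add_comm]
    congr 1
    · congr 1
      refine Finset.sum_congr rfl fun s _ => ?_
      rw [add_comm 1 s, show oddCount true w - 1 - s = oddCount true w - (s + 1) by omega]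
    · simp [oddPartsValue, normalizedCatalan_zero_zero]

/-- The universal character on a ribbon: `1` on a single row and `0` otherwise. -/
def rowValue : List RibbonStep → ℚ
  | [] => 1
  | right :: w => rowValue w
  | down :: _ => 0
  | diff :: w => rowValue w

theorem additive_rowValue : Additive rowValue := by
  intro u w
  induction u with
  | nil => simp [rowValue]
  | cons a u ih => cases a <;> simp [rowValue, ih]

/-- The flag affects only the parity of the first part. If another part follows, the two signs are
opposite; if not, exactly one flag makes the single part odd. -/
theorem evenSign_add_evenSign (w : List RibbonStep) (hw : right ∉ w) :
    evenSign true w + evenSign false w = rowValue w := by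
  induction w with
  | nil => simp [evenSign, rowValue]
  | cons a w ih =>
    have ih := ih fun h => hw (List.mem_cons_of_mem _ h)
    cases a with
    | right => simp at hw
    | down => simp [evenSign, rowValue]
    | diff => simp [evenSign, rowValue, ← ih, add_comm]

/-- The universal character is the product of its even and odd parts. -/
theorem value_add_cutSum_even_eq_rowValue (w : List RibbonStep) :
    value false 1 w +
      cutSum (fun u => (if Even (1 + u.length) then 1 else 0) * value true 0 u) (value false 1) w =
        rowValue w := by
  set ω : ℕ → ℚ := fun m => if Even m then 1 else 0 with hωdef
  refine Additive.eq_of_forall_right_notMem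
    (f := fun w => value false 1 w +
      cutSum (fun u => ω (1 + u.length) * value true 0 u) (value false 1) w)
    ?_ additive_rowValue ?_ w
  · intro u w
    have h := (additive_mul_value ω true 0 1).cutSum (additive_value false 1) u w
    simp only at h ⊢
    rw [h, additive_value false 1 u w]
    ring
  · intro w hw
    have hω : ∀ m, ω (m + 2) = ω m := fun m => by
      simp [hωdef, Nat.even_add]
    have ho := evenSign_mul_sum_range ω hω true w
    have h01 : ω 0 + ω 1 = 1 := by simp [hωdef]
    rw [h01, mul_one] at ho
    have hsplit : (fun u : List RibbonStep => ω (1 + u.length) * value true 0 u) = fun u =>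
        ω (1 + u.length) * value false 1 u +
          ω (0 + 1 + u.length) * value false 0 (diff :: u) := by
      funext u
      rw [value_true_eq_add, zero_add, mul_add]
    simp only [hsplit, cutSum_add, (cutSum_value ω hω w hw 1).1, (cutSum_value ω hω w hw 0).2,
      (value_eq_evenSign_mul w hw 1).1, zero_add]
    rw [← evenSign_add_evenSign w hw, ← add_assoc]
    congr 1
    · refine Eq.trans ?_ ho
      rw [Finset.sum_range_succ', mul_add, add_comm]
      congr 1
      · congr 1
        refine Finset.sum_congr rfl fun s _ => ?_
        rw [add_comm 1 s, show oddCount true w - 1 - s = oddCount true w - (s + 1) by omega]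
      · simp [oddPartsValue, normalizedCatalan_zero_zero, hωdef]
    -- The convolution lemma needs at least two terms: with no odd part the sign vanishes, and with
    -- one the sum is the single term `ω 0 = 1`.
    · rcases h : oddCount false w with _ | K
      · simp [evenSign_eq_zero h]
      · rcases K with _ | K
        · simp [oddPartsValue, normalizedCatalan_zero_zero, hωdef]
        · have := sum_range_periodic_mul_oddPartsValue ω hω K
          rw [h01] at this
          simp only [Nat.add_sub_cancel, this, mul_one]

end RibbonStep

/-! ### Closed form of the values in terms of peaks. -/

namespace RibbonStep

/-- The number of steps to the right immediately followed by a step down in a word; the flag says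
whether the preceding step was to the right. -/
def peakCount : Bool → List RibbonStep → ℕ
  | _, [] => 0
  | _, right :: w => peakCount true w
  | true, down :: w => peakCount false w + 1
  | false, down :: w => peakCount false w
  | _, diff :: w => peakCount false w

/-- Each peak uses up two steps. This keeps the natural number subtractions in the arguments of `C`
from truncating. -/
theorem two_mul_peakCount_le (w : List RibbonStep) :
    2 * peakCount false w ≤ w.length ∧ 2 * peakCount true w ≤ w.length + 1 := by
  induction w with
  | nil => simp [peakCount]
  | cons a w ih =>
    cases a <;> simp only [peakCount, List.length_cons] <;> omega

theorem value_eq_normalizedCatalan (w : List RibbonStep) (hw : diff ∉ w) (k : ℕ) :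
    value false k w = (-1) ^ peakCount false w *
        normalizedCatalan (peakCount false w) ((k + w.length) / 2 - peakCount false w) ∧
      value true k w = (-1) ^ peakCount true w *
        normalizedCatalan (peakCount true w) ((k + 1 + w.length) / 2 - peakCount true w) := by
  induction w generalizing k with
  | nil => simp [value, peakCount, oddPartsValue]
  | cons a w ih =>
    have ih := ih fun h => hw (List.mem_cons_of_mem _ h)
    cases a with
    | right =>
      refine ⟨?_, ?_⟩
      · rw [value, (ih k).2, peakCount, List.length_cons, add_right_comm, add_assoc]
      · rw [value, (ih (k + 1)).2, peakCount, List.length_cons, add_right_comm (k + 1), add_assoc]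
    | down =>
      refine ⟨?_, ?_⟩
      · rw [value, (ih (k + 1)).1, peakCount, List.length_cons, add_right_comm, add_assoc]
      · have hp := (two_mul_peakCount_le w).1
        rw [value, (ih (k + 2)).1, (ih k).1, peakCount, List.length_cons]
        set p := peakCount false w
        rw [show (k + 2 + w.length) / 2 - p = ((k + w.length) / 2 - p) + 1 by omega,
          show (k + 1 + (w.length + 1)) / 2 - (p + 1) = (k + w.length) / 2 - p by omega,
          normalizedCatalan_eq_add p ((k + w.length) / 2 - p)]
        ring
    | diff => simp at hw

/-! ### Words of ribbon diagrams and their cuts. -/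

/-- The steps of the ribbon with given row lengths, each row being preceded by a step down. -/
def ofBlocks : List ℕ → List RibbonStep
  | [] => []
  | a :: l => down :: (List.replicate (a - 1) right ++ ofBlocks l)

theorem diff_notMem_ofBlocks (l : List ℕ) : diff ∉ ofBlocks l := by
  induction l with
  | nil => simp [ofBlocks]
  | cons a l ih => simp [ofBlocks, ih]

theorem length_ofBlocks {l : List ℕ} (hl : ∀ b ∈ l, 0 < b) :
    (ofBlocks l).length = l.sum := by
  induction l with
  | nil => rfl
  | cons a l ih =>
    have ha := hl a (by simp)
    simp only [ofBlocks, List.length_cons, List.length_append, List.length_replicate,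
      ih fun b hb => hl b (List.mem_cons_of_mem _ hb), List.sum_cons]
    omega

theorem ofBlocks_cutLeftBlocks {l : List ℕ} (hl : ∀ b ∈ l, 0 < b) (i : ℕ) :
    ofBlocks (Composition.cutLeftBlocks i l) = (ofBlocks l).take i := by
  induction l generalizing i with
  | nil => simp [Composition.cutLeftBlocks, ofBlocks]
  | cons a l ih =>
    have ha := hl a (by simp)
    have ih := ih fun b hb => hl b (List.mem_cons_of_mem _ hb)
    rcases i with _ | i
    · simp [Composition.cutLeftBlocks, ofBlocks]
    · unfold Composition.cutLeftBlocks
      rw [if_neg (Nat.succ_ne_zero i)]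
      split_ifs with h
      · simp only [ofBlocks, List.take_succ_cons, List.append_nil, Nat.add_sub_cancel]
        rw [List.take_append_of_le_length (by simp; omega), List.take_replicate,
          min_eq_left (by omega)]
      · simp only [ofBlocks, List.take_succ_cons, ih, List.take_append, List.length_replicate,
          List.take_replicate]
        rw [min_eq_right (by omega), show i + 1 - a = i - (a - 1) by omega]

/-- Tails are compared because a cut inside a row turns a `right` into the `down` that opens the
right piece. -/
theorem tail_ofBlocks_cutRightBlocks {l : List ℕ} (hl : ∀ b ∈ l, 0 < b) (i : ℕ) :
    (ofBlocks (Composition.cutRightBlocks i l)).tail = (ofBlocks l).drop (i + 1) := by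
  induction l generalizing i with
  | nil => simp [Composition.cutRightBlocks, ofBlocks]
  | cons a l ih =>
    have ha := hl a (by simp)
    have ih := ih fun b hb => hl b (List.mem_cons_of_mem _ hb)
    unfold Composition.cutRightBlocks
    split_ifs with h
    · simp only [ofBlocks, List.tail_cons, List.drop_succ_cons]
      rw [List.drop_append_of_le_length (by simp; omega), List.drop_replicate,
        show a - i - 1 = a - 1 - i by omega]
    · rw [ih, ofBlocks, List.drop_succ_cons, List.drop_append, List.drop_replicate,
        List.length_replicate, Nat.sub_eq_zero_of_le (show a - 1 ≤ i by omega),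
        show i - a + 1 = i - (a - 1) by omega]
      simp

theorem peakCount_replicate_append (b : Bool) (m : ℕ) (w : List RibbonStep) :
    peakCount b (List.replicate m right ++ w) = peakCount (b || decide (0 < m)) w := by
  induction m generalizing b with
  | zero => simp
  | succ m ih => simp [List.replicate_succ, peakCount, ih]

/-- A `down` follows a `right` exactly on leaving a row of more than one square that is not the last
row. -/
theorem peakCount_false_ofBlocks (l : List ℕ) :
    peakCount false (ofBlocks l) =
      ∑ i : Fin l.length, if (i : ℕ) + 1 ≠ l.length ∧ 1 < l.get i then 1 else 0 := by
  induction l with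
  | nil => simp [ofBlocks, peakCount]
  | cons a l ih =>
    have hsucc : (∑ i : Fin l.length, if (i.succ : ℕ) + 1 ≠ (a :: l).length ∧
        1 < (a :: l).get i.succ then 1 else 0) = peakCount false (ofBlocks l) := by
      rw [ih]
      refine Finset.sum_congr rfl fun i _ => ?_
      simp
    refine Eq.trans ?_ (Fin.sum_univ_succ (n := l.length) _).symm
    refine Eq.trans ?_ (congrArg (_ + ·) hsucc.symm)
    rw [ofBlocks, peakCount, peakCount_replicate_append]
    rcases l with _ | ⟨b, l⟩
    · simp [ofBlocks, peakCount]
    · by_cases h : 1 < a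
      · simp [ofBlocks, peakCount, h, add_comm]
      · simp [ofBlocks, peakCount, h]

theorem rowValue_tail_ofBlocks_cons {a : ℕ} (l : List ℕ) :
    rowValue (ofBlocks (a :: l)).tail = if l = [] then 1 else 0 := by
  have h (m : ℕ) (w : List RibbonStep) :
      rowValue (List.replicate m right ++ w) = rowValue w := by
    induction m with
    | zero => simp
    | succ m ih => simpa [List.replicate_succ, rowValue] using ih
  rw [ofBlocks, List.tail_cons, h]
  cases l <;> simp [ofBlocks, rowValue]

end RibbonStep

/-! ### Transfer to compositions. -/

namespace Composition

open RibbonStep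

theorem peakMinus_eq_peakCount {n : ℕ} (α : Composition n) :
    α.peakMinus = peakCount false (ofBlocks α.blocks) := by
  rw [peakCount_false_ofBlocks, peakMinus, Finset.card_filter]
  rfl

/-- With the flag set, leaving the first row counts as a peak whatever its length; this is the
summand 1 in `peakPlus`. -/
theorem peakPlus_eq_peakCount {n : ℕ} (α : Composition n) :
    α.peakPlus = peakCount true (ofBlocks α.blocks).tail := by
  have hplus : α.peakPlus = if 1 < α.blocks.length then
      1 + ∑ i : Fin α.blocks.length, (if (i : ℕ) + 1 ≠ 1 ∧ (i : ℕ) + 1 ≠ α.blocks.length ∧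
        1 < α.blocks.get i then 1 else 0) else 0 := by
    rw [peakPlus, Finset.card_filter]
    rfl
  rw [hplus]
  rcases α.blocks with _ | ⟨a, _ | ⟨b, l⟩⟩
  · simp [ofBlocks, peakCount]
  · have := peakCount_replicate_append true (a - 1) []
    simp only [List.append_nil] at this
    simp [ofBlocks, this, peakCount]
  · have h := peakCount_false_ofBlocks (b :: l)
    rw [if_pos (by simp), ofBlocks, List.tail_cons, peakCount_replicate_append, Bool.true_or]
    have hsucc : (∑ i : Fin (b :: l).length, if (i.succ : ℕ) + 1 ≠ 1 ∧
        (i.succ : ℕ) + 1 ≠ (a :: b :: l).length ∧ 1 < (a :: b :: l).get i.succ then 1 else 0) =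
          peakCount false (ofBlocks (b :: l)) := by
      rw [h]
      refine Finset.sum_congr rfl fun i _ => ?_
      simp
    refine Eq.trans (congrArg (1 + ·) (Fin.sum_univ_succ (n := (b :: l).length) _)) ?_
    refine Eq.trans (congrArg (fun x => 1 + (_ + x)) hsucc) ?_
    simp [ofBlocks, peakCount, add_comm]

/-- The steps of the ribbon diagram of a composition, read from left to right and top to bottom. -/
def steps {n : ℕ} (α : Composition n) : List RibbonStep :=
  (ofBlocks α.blocks).tail

theorem ofBlocks_blocks {n : ℕ} (hn : 0 < n) (α : Composition n) :
    ofBlocks α.blocks = down :: α.steps := by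
  rw [steps]
  rcases h : α.blocks with _ | ⟨a, l⟩
  · have := α.blocks_sum
    simp [h] at this
    omega
  · simp [ofBlocks]

theorem length_ofBlocks_blocks {n : ℕ} (α : Composition n) : (ofBlocks α.blocks).length = n := by
  rw [length_ofBlocks fun _ hb => α.blocks_pos hb, α.blocks_sum]

theorem length_steps {n : ℕ} (α : Composition n) : α.steps.length = n - 1 := by
  rw [steps, List.length_tail, length_ofBlocks_blocks]

theorem diff_notMem_steps {n : ℕ} (α : Composition n) : diff ∉ α.steps :=
  fun h => diff_notMem_ofBlocks α.blocks (List.mem_of_mem_tail h)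

theorem rowValue_steps {n : ℕ} (hn : 0 < n) (α : Composition n) :
    rowValue α.steps = if α = single n hn then 1 else 0 := by
  have hs : (α = single n hn) ↔ α.blocks.length = 1 := eq_single_iff_length hn
  rw [steps]
  simp only [hs]
  rcases h : α.blocks with _ | ⟨a, l⟩
  · have := α.blocks_sum
    simp [h] at this
    omega
  · simp [rowValue_tail_ofBlocks_cons]

/-- The value at `α` of the odd part of the universal character. -/
def minusValue {n : ℕ} (α : Composition n) : ℚ :=
  (-1) ^ α.peakMinus * normalizedCatalan α.peakMinus (n / 2 - α.peakMinus)

/-- The value at `α`, a composition of an even number, of the even part of the universal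
character. -/
def plusValue {n : ℕ} (α : Composition n) : ℚ :=
  (-1) ^ α.peakPlus * normalizedCatalan α.peakPlus (n / 2 - α.peakPlus)

theorem minusValue_eq_value {n : ℕ} (α : Composition n) :
    α.minusValue = value false 0 (ofBlocks α.blocks) := by
  rw [(value_eq_normalizedCatalan _ (diff_notMem_ofBlocks _) 0).1, length_ofBlocks_blocks,
    ← peakMinus_eq_peakCount, zero_add, minusValue]

theorem minusValue_eq_value_steps {n : ℕ} (hn : 0 < n) (α : Composition n) :
    α.minusValue = value false 1 α.steps := by
  rw [minusValue_eq_value, ofBlocks_blocks hn, value]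

theorem plusValue_eq_value_steps {n : ℕ} (hn : 0 < n) (α : Composition n) :
    α.plusValue = value true 0 α.steps := by
  rw [(value_eq_normalizedCatalan _ α.diff_notMem_steps 0).2, length_steps, steps,
    ← peakPlus_eq_peakCount, plusValue, show 0 + 1 + (n - 1) = n by omega]

theorem two_mul_peakMinus_le {n : ℕ} (α : Composition n) : 2 * α.peakMinus ≤ n := by
  have := (two_mul_peakCount_le (ofBlocks α.blocks)).1
  rwa [length_ofBlocks_blocks, ← peakMinus_eq_peakCount] at this

theorem two_mul_peakPlus_le {n : ℕ} (α : Composition n) : 2 * α.peakPlus ≤ n := by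
  rcases Nat.eq_zero_or_pos n with rfl | hn
  · have h : α.steps = [] := List.length_eq_zero_iff.1 (by rw [length_steps])
    rw [peakPlus_eq_peakCount, ← steps, h, peakCount]
  · have := (two_mul_peakCount_le α.steps).2
    rw [length_steps, steps, ← peakPlus_eq_peakCount] at this
    omega

/-- A piece of `i + 1` squares has `i` steps; the step being cut belongs to neither piece. -/
theorem steps_leftPiece {n : ℕ} (hn : 0 < n) (α : Composition n) (i : ℕ) :
    (α.leftPiece (i + 1)).steps = α.steps.take i := by
  rw [steps, leftPiece, ofBlocks_cutLeftBlocks fun _ hb => α.blocks_pos hb, ofBlocks_blocks hn]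
  rfl

theorem steps_rightPiece {n : ℕ} (hn : 0 < n) (α : Composition n) (i : ℕ) :
    (α.rightPiece i).steps = α.steps.drop i := by
  rw [steps, rightPiece, tail_ofBlocks_cutRightBlocks fun _ hb => α.blocks_pos hb,
    ofBlocks_blocks hn, List.drop_succ_cons]

/-- The sum over all cuts of a ribbon diagram, as a sum over all cuts of its word of steps. -/
theorem sum_range_eq_value_add_cutSum {n : ℕ} (hn : 0 < n) (α : Composition n) (f : ℕ → ℚ)
    (F : List RibbonStep → ℚ) (h0 : f 0 = 1)
    (hf : ∀ i < n, f (i + 1) = F (α.steps.take i)) :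
    ∑ i ∈ Finset.range (n + 1), f i * (α.rightPiece i).minusValue =
      value false 1 α.steps + cutSum F (value false 1) α.steps := by
  obtain ⟨m, rfl⟩ : ∃ m, n = m + 1 := ⟨n - 1, by omega⟩
  have hright (i : ℕ) (hi : i < m + 1) :
      (α.rightPiece i).minusValue = value false 1 (α.steps.drop i) := by
    rw [minusValue_eq_value_steps (by omega), steps_rightPiece hn]
  have hlen : α.steps.length = m := by rw [length_steps, Nat.add_sub_cancel]
  have hlast : (α.rightPiece (m + 1)).minusValue = 1 := by
    have h := (α.rightPiece (m + 1)).two_mul_peakMinus_le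
    have h : (α.rightPiece (m + 1)).peakMinus = 0 := by omega
    simp [minusValue, h, normalizedCatalan_zero_zero]
  -- The two outer edges are split off: edge 0 gives the isolated summand, the last edge gives the
  -- end term of `cutSum`.
  rw [cutSum_eq_sum_range _ _ _ α.diff_notMem_steps, Finset.sum_range_succ',
    Finset.sum_range_succ, h0, hright 0 (by omega), hlast, hf m (by omega), hlen,
    List.take_of_length_le hlen.le, List.drop_zero, one_mul, mul_one,
    add_comm]
  congr 2
  refine Finset.sum_congr rfl fun i hi => ?_
  have hi := Finset.mem_range.1 hi
  rw [hf i (by omega), hright (i + 1) (by omega)]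

theorem sum_minusValue_mul_minusValue {n : ℕ} (hn : 0 < n) (α : Composition n) :
    ∑ i ∈ Finset.range (n + 1),
      (-1) ^ i * (α.leftPiece i).minusValue * (α.rightPiece i).minusValue = 0 := by
  rw [← value_add_cutSum_conjugate_eq_zero α.steps]
  refine sum_range_eq_value_add_cutSum hn α
    (fun i => (-1) ^ i * (α.leftPiece i).minusValue) _ ?_ fun i hi => ?_
  · have h := (α.leftPiece 0).two_mul_peakMinus_le
    have h : (α.leftPiece 0).peakMinus = 0 := by omega
    simp [minusValue, h, normalizedCatalan_zero_zero]
  · rw [minusValue_eq_value_steps (by omega), steps_leftPiece hn, List.length_take, length_steps,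
      min_eq_left (by omega), add_comm 1 i]

theorem sum_plusValue_mul_minusValue {n : ℕ} (hn : 0 < n) (α : Composition n) :
    ∑ j ∈ Finset.range (n / 2 + 1),
      (α.leftPiece (2 * j)).plusValue * (α.rightPiece (2 * j)).minusValue =
        if α = single n hn then 1 else 0 := by
  rw [← rowValue_steps hn, ← value_add_cutSum_even_eq_rowValue α.steps,
    ← sum_range_eq_value_add_cutSum hn α
      (fun i => (if Even i then 1 else 0) * (α.leftPiece i).plusValue)]
  · simp only [ite_mul, one_mul, zero_mul]
    rw [← Finset.sum_filter]
    refine Finset.sum_bij (fun j _ => 2 * j) ?_ ?_ ?_ ?_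
    · intro j hj
      have := Finset.mem_range.1 hj
      simp only [Finset.mem_filter, Finset.mem_range, even_two_mul, and_true]
      omega
    · intro a _ b _ h
      simpa using h
    · intro i hi
      obtain ⟨hi, hi'⟩ := Finset.mem_filter.1 hi
      obtain ⟨j, rfl⟩ := even_iff_two_dvd.1 hi'
      have := Finset.mem_range.1 hi
      exact ⟨j, Finset.mem_range.2 (by omega), rfl⟩
    · intro j _
      rfl
  · have h := (α.leftPiece 0).two_mul_peakPlus_le
    have h : (α.leftPiece 0).peakPlus = 0 := by omega
    simp [plusValue, h, normalizedCatalan_zero_zero]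
  · intro i hi
    rw [plusValue_eq_value_steps (by omega), steps_leftPiece hn, List.length_take, length_steps,
      min_eq_left (by omega), add_comm 1 i]

theorem minusValue_eq_bivariateCatalan {n : ℕ} (α : Composition n) :
    α.minusValue = (-1) ^ α.peakMinus * bivariateCatalan α.peakMinus (n / 2 - α.peakMinus) /
      4 ^ (n / 2) := by
  have := α.two_mul_peakMinus_le
  rw [bivariateCatalan_eq_four_pow_mul, show α.peakMinus + (n / 2 - α.peakMinus) = n / 2 by omega,
    minusValue]
  field_simp

theorem plusValue_eq_bivariateCatalan {n : ℕ} (α : Composition n) :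
    α.plusValue = (-1) ^ α.peakPlus * bivariateCatalan α.peakPlus (n / 2 - α.peakPlus) /
      4 ^ (n / 2) := by
  have := α.two_mul_peakPlus_le
  rw [bivariateCatalan_eq_four_pow_mul, show α.peakPlus + (n / 2 - α.peakPlus) = n / 2 by omega,
    plusValue]
  field_simp

end Composition

theorem propositionP (n : ℕ) (hn : 0 < n) (α : Composition n) :
    (∑ j ∈ Finset.range (n / 2 + 1),
        (-1 : ℚ) ^ ((α.leftPiece (2 * j)).peakPlus + (α.rightPiece (2 * j)).peakMinus) *
          bivariateCatalan (α.leftPiece (2 * j)).peakPlus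
            (j - (α.leftPiece (2 * j)).peakPlus) *
          bivariateCatalan (α.rightPiece (2 * j)).peakMinus
            (n / 2 - j - (α.rightPiece (2 * j)).peakMinus)
      = if α = Composition.single n hn then (4 : ℚ) ^ (n / 2) else 0) ∧
    (∑ i ∈ Finset.range (n + 1),
        (-1 : ℚ) ^ ((α.leftPiece i).peakMinus + (α.rightPiece i).peakMinus + i) /
            (4 : ℚ) ^ (i / 2 + (n - i) / 2) *
          bivariateCatalan (α.leftPiece i).peakMinus
            (i / 2 - (α.leftPiece i).peakMinus) *
          bivariateCatalan (α.rightPiece i).peakMinus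
            ((n - i) / 2 - (α.rightPiece i).peakMinus)
      = 0) := by
  refine ⟨?_, ?_⟩
  · have h : (if α = Composition.single n hn then (4 : ℚ) ^ (n / 2) else 0) =
        4 ^ (n / 2) * if α = Composition.single n hn then 1 else 0 := by
      rw [mul_ite, mul_one, mul_zero]
    rw [h, ← α.sum_plusValue_mul_minusValue hn, Finset.mul_sum]
    refine Finset.sum_congr rfl fun j hj => ?_
    have hj := Finset.mem_range.1 hj
    rw [Composition.plusValue_eq_bivariateCatalan, Composition.minusValue_eq_bivariateCatalan,
      show min (2 * j) n / 2 = j by omega, show (n - 2 * j) / 2 = n / 2 - j by omega]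
    -- As `2 * j` is even, the floors of the half degrees add up to `n / 2`, so the power of 4 is
    -- the same in all terms.
    have h4 : (4 : ℚ) ^ (n / 2) = 4 ^ j * 4 ^ (n / 2 - j) := by
      rw [← pow_add, show j + (n / 2 - j) = n / 2 by omega]
    rw [h4, pow_add]
    field_simp
  · rw [← α.sum_minusValue_mul_minusValue hn]
    refine Finset.sum_congr rfl fun i hi => ?_
    have hi := Finset.mem_range.1 hi
    rw [Composition.minusValue_eq_bivariateCatalan, Composition.minusValue_eq_bivariateCatalan,
      show min i n / 2 = i / 2 by omega, pow_add, pow_add, pow_add]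
    field_simp
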